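/- Let $a,b>0$, let $N\ge 1$ be an integer, and let $\sigma_{ij}:\mathbb R\to\mathbb C\cup\{\infty\}$ ($1\le i,j\le N$) be $b$-periodic functions, i.e. $\sigma_{ij}(x+b)=\sigma_{ij}(x)$ for all $x$, that are finite almost everywhere. Let $n_0$ and $n_{ij}$ ($1\le i,j\le N$) be integers with $n_0\notin[\min_{i,j}n_{ij},\,\max_{i,j}n_{ij}]$. For $t\in\mathbb R$ let $T_t$ be the translation operator on the complex space $L^2(\mathbb R)$, $(T_tf)(x)=f(x-t)$. Then: 1. There are no $g_1,\dots,g_N\in L^2(\mathbb R)$, not all zero, such that for every $1\le i\le N$ $$T_{an_0}g_i=\sum_{j=1}^N\sigma_{ij}\,T_{an_{ij}}g_j\quad\text{almost everywhere on }\mathbb R.$$ 2. For any $g_1,\dots,g_N\in L^2(\mathbb R)$, not all zero, there is at least one $1\le i\le N$ for which $$T_{an_0}g_i\neq\sum_{j=1}^N\sigma_{ij}\,T_{an_{ij}}g_i$$ on a set of positive (outer) Lebesgue measure. (When the $\sigma_{ij}$ are measurable this is a set of positive measure.) -/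

import Mathlib

open MeasureTheory

/-- The space `L²(ℝ)` of square-integrable complex-valued functions on the real line. -/
abbrev L2R : Type := Lp ℂ 2 (volume : Measure ℝ)

/-- The translation operator `T_t` on `L²(ℝ)`, given by `(T_t f)(x) = f (x - t)`. -/
noncomputable def translationOp (t : ℝ) : L2R →ₗᵢ[ℂ] L2R :=
  Lp.compMeasurePreservingₗᵢ ℂ (fun x : ℝ => x - t) (measurePreserving_sub_right volume t)

theorem translationOp_ae (t : ℝ) (f : L2R) :
    translationOp t f =ᵐ[volume] fun x => f (x - t) :=
  Lp.coeFn_compMeasurePreserving f (measurePreserving_sub_right volume t)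

/-- `σ : ℝ → ℂ ∪ {∞}` is a `b`-periodic function that is finite almost everywhere. -/
def IsPeriodicAEFinite (b : ℝ) (σ : ℝ → OnePoint ℂ) : Prop :=
  Function.Periodic σ b ∧ ∀ᵐ x : ℝ, σ x ≠ OnePoint.infty

/-- The complex number underlying a finite element of `ℂ ∪ {∞}`. The value at `∞` is a
convention, which is used only on null sets. -/
def finiteValue (z : OnePoint ℂ) : ℂ := z.elim 0 id

/-- The saturation `E + b ℤ` of a set of reals. -/
def latticeSaturation (b : ℝ) (E : Set ℝ) : Set ℝ :=
  {x | ∃ y ∈ E, ∃ k : ℤ, x = y + b * k}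

/-- The system of `b`-periodic equations of translates
`σ_k T_{α_k} g_k = ∑_j σ_{kj} T_{α_{kj}} g_j` (`1 ≤ k ≤ N`) is solvable on `E`: some
`g_1, …, g_N` in `L²(ℝ)`, not all zero, satisfy all the equations
almost everywhere on `E + b ℤ`. -/
def SolvableOn (b : ℝ) {N : ℕ}
    (σ₀ : Fin N → ℝ → OnePoint ℂ) (σ : Fin N → Fin N → ℝ → OnePoint ℂ)
    (α₀ : Fin N → ℝ) (α : Fin N → Fin N → ℝ) (E : Set ℝ) : Prop :=
  ∃ g : Fin N → L2R, (∃ i, g i ≠ 0) ∧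
    ∀ k, ∀ᵐ x : ℝ, x ∈ latticeSaturation b E →
      finiteValue (σ₀ k x) * translationOp (α₀ k) (g k) x
        = ∑ j, finiteValue (σ k j x) * translationOp (α k j) (g j) x

open scoped ENNReal

/-- Vectors in a module that are determined by a recurrence with bounded memory: all those with
nonpositive index lie in a common subspace of controlled dimension. -/
theorem exists_finrank_le_of_recurrence {K V ι S : Type*} [Field K] [AddCommGroup V] [Module K V]
    [Fintype ι] [Fintype S] (M : ℕ) (r : ι → S → ι) (m : ι → S → ℤ)
    (hm : ∀ i s, 0 < m i s) (hM : ∀ i s, m i s ≤ M) (v : ι → ℤ → V) (c : ι → S → ℤ → K)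
    (h : ∀ i k, v i k = ∑ s, c i s k • v (r i s) (k + m i s)) :
    ∃ W : Submodule K V, FiniteDimensional K W ∧
      Module.finrank K W ≤ Fintype.card (ι × Fin M) ∧ ∀ i, ∀ k ≤ 0, v i k ∈ W := by
  let w : ι × Fin M → V := fun q => v q.1 (q.2 + 1)
  refine ⟨Submodule.span K (Set.range w), FiniteDimensional.span_of_finite K (Set.finite_range w),
    finrank_range_le_card w, ?_⟩
  have key : ∀ n : ℕ, ∀ i, v i (M - n) ∈ Submodule.span K (Set.range w) := by
    intro n
    induction n using Nat.strong_induction_on with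
    | _ n ih =>
      intro i
      by_cases hn : n < M
      · refine Submodule.subset_span ⟨(i, ⟨M - n - 1, by omega⟩), ?_⟩
        simp only [w]
        congr 1
        omega
      · rw [h]
        refine Submodule.sum_mem _ fun s _ => Submodule.smul_mem _ _ ?_
        have h1 := hm i s
        have h2 := hM i s
        have h3 := ih (n - (m i s).toNat) (by omega) (r i s)
        convert! h3 using 2
        omega
  intro i k hk
  have := key (M - k).toNat i
  convert! this using 2
  omega

theorem lp_tsum_enorm_sq {α : Type*} (w : lp (fun _ : α => ℂ) 2) :
    ∑' l, ‖w l‖ₑ ^ 2 = ‖w‖ₑ ^ 2 := by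
  have h : HasSum (fun l => ‖w l‖ ^ 2) (‖w‖ ^ 2) := by
    simpa using lp.hasSum_norm (p := 2) (by norm_num) w
  simp_rw [← ofReal_norm, ← ENNReal.ofReal_pow (norm_nonneg _)]
  rw [← h.tsum_eq, ENNReal.ofReal_tsum_of_nonneg (fun _ => by positivity) h.summable]

theorem memℓp_two_of_tsum_enorm_sq_ne_top {α : Type*} {f : α → ℂ} (h : ∑' l, ‖f l‖ₑ ^ 2 ≠ ∞) :
    Memℓp f 2 := by
  refine memℓp_gen ?_
  simpa using ENNReal.summable_toReal h

/-- The diagonal of the projection onto a finite-dimensional subspace of `ℓ²` has sum equal to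
the dimension, and dominates the squared coordinates of the unit vectors of the subspace. -/
theorem exists_diagonal_bound {α : Type*} (W : Submodule ℂ (lp (fun _ : α => ℂ) 2))
    [FiniteDimensional ℂ W] :
    ∃ D : α → ℝ≥0∞, ∑' l, D l = Module.finrank ℂ W ∧
      ∀ w ∈ W, ∀ l, ‖w l‖ₑ ^ 2 ≤ D l * ‖w‖ₑ ^ 2 := by
  let e := stdOrthonormalBasis ℂ W
  refine ⟨fun l => ∑ i, ‖(e i : lp (fun _ : α => ℂ) 2) l‖ₑ ^ 2, ?_, ?_⟩
  · rw [Summable.tsum_finsetSum (fun _ _ => ENNReal.summable)]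
    simp_rw [lp_tsum_enorm_sq]
    have (i : Fin (Module.finrank ℂ W)) : ‖(e i : lp (fun _ : α => ℂ) 2)‖ₑ = 1 := by
      rw [← ofReal_norm, ← Submodule.coe_norm, e.orthonormal.1 i, ENNReal.ofReal_one]
    simp [this]
  · intro w hw l
    have h1 : w l = ∑ i, e.repr ⟨w, hw⟩ i * (e i : lp (fun _ : α => ℂ) 2) l := by
      have h2 := congrArg (Subtype.val : W → lp (fun _ : α => ℂ) 2) (e.sum_repr ⟨w, hw⟩)
      simp only [AddSubmonoidClass.coe_finsetSum, Submodule.coe_smul] at h2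
      have h2' := congrArg (fun z : lp (fun _ : α => ℂ) 2 => z l) h2
      simp only [lp.coeFn_sum, Finset.sum_apply, lp.coeFn_smul, Pi.smul_apply, smul_eq_mul] at h2'
      exact h2'.symm
    have h3 : ‖w‖ ^ 2 = ∑ i, ‖e.repr ⟨w, hw⟩ i‖ ^ 2 := by
      rw [← EuclideanSpace.norm_sq_eq, LinearIsometryEquiv.norm_map, Submodule.coe_norm]
    have h4 : ‖w l‖ ^ 2 ≤ (∑ i, ‖(e i : lp (fun _ : α => ℂ) 2) l‖ ^ 2) * ‖w‖ ^ 2 := by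
      calc ‖w l‖ ^ 2 ≤ (∑ i, ‖e.repr ⟨w, hw⟩ i‖ * ‖(e i : lp (fun _ : α => ℂ) 2) l‖) ^ 2 := by
            rw [h1]
            gcongr
            exact (norm_sum_le _ _).trans_eq (by simp_rw [norm_mul])
        _ ≤ (∑ i, ‖e.repr ⟨w, hw⟩ i‖ ^ 2) * ∑ i, ‖(e i : lp (fun _ : α => ℂ) 2) l‖ ^ 2 :=
            Finset.sum_mul_sq_le_sq_mul_sq _ _ _
        _ = _ := by rw [h3, mul_comm]
    have h5 := ENNReal.ofReal_le_ofReal h4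
    rw [ENNReal.ofReal_mul (by positivity), ENNReal.ofReal_sum_of_nonneg (by intros; positivity)]
      at h5
    simpa only [← ofReal_norm, ENNReal.ofReal_pow (norm_nonneg _)] using h5

theorem lintegral_eq_lintegral_Ioc_tsum {c : ℝ} (hc : 0 < c) (t : ℝ) {f : ℝ → ℝ≥0∞}
    (hf : Measurable f) :
    ∫⁻ x, f x = ∫⁻ x in Set.Ioc t (t + c), ∑' k : ℤ, f (x + c * k) := by
  let e : ℤ ≃ AddSubgroup.zmultiples c :=
    Equiv.ofBijective (fun k => ⟨k • c, k, rfl⟩) ⟨fun k l h => by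
      simpa [hc.ne'] using congrArg Subtype.val h, fun ⟨_, k, h⟩ => ⟨k, Subtype.ext h⟩⟩
  have he (k : ℤ) (x : ℝ) : e k +ᵥ x = x + c * k := by
    change k • c + x = _
    rw [zsmul_eq_mul]
    ring
  rw [(isAddFundamentalDomain_Ioc hc t volume).lintegral_eq_tsum'', ← e.tsum_eq, lintegral_tsum]
  · simp_rw [he]
  · exact fun k => (hf.comp (measurable_id.add_const _)).aemeasurable

theorem ae_tsum_ne_top {c : ℝ} (hc : 0 < c) {f : ℝ → ℝ≥0∞} (hf : Measurable f)
    (h : ∫⁻ x, f x ≠ ∞) : ∀ᵐ x, ∑' k : ℤ, f (x + c * k) ≠ ∞ := by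
  rw [← Measure.restrict_univ (μ := volume), ← iUnion_Ioc_add_zsmul hc 0, ae_restrict_iUnion_iff]
  intro n
  rw [lintegral_eq_lintegral_Ioc_tsum hc (n • c) hf] at h
  have hm : Measurable fun x => ∑' k : ℤ, f (x + c * k) :=
    Measurable.tsum fun k => hf.comp (measurable_id.add_const _)
  simp only [zero_add, add_zsmul, one_zsmul]
  filter_upwards [ae_lt_top hm h] with x hx using hx.ne

/-- A monotone function on `ℤ` with values in `[0, ∞]` and finite sum vanishes. -/
theorem eq_zero_of_monotone_of_tsum_ne_top {u : ℤ → ℝ≥0∞} (hu : Monotone u)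
    (h : ∑' k, u k ≠ ∞) (k : ℤ) : u k = 0 := by
  by_contra h0
  refine h (top_unique ?_)
  calc ∞ = ∑' _ : ℕ, u k := (ENNReal.tsum_const_eq_top_of_ne_zero h0).symm
    _ ≤ ∑' n : ℕ, u (k + n) := ENNReal.tsum_le_tsum fun n => hu (by omega)
    _ ≤ ∑' k, u k := ENNReal.tsum_comp_le_tsum_of_injective
        (f := fun n : ℕ => k + (n : ℤ)) (fun p q hpq => by simpa using hpq) u

theorem ae_eq_zero_of_le_add {a : ℝ} (ha : a ≠ 0) {p : ℝ → ℝ≥0∞} (hp : Measurable p)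
    (hmono : ∀ x, p x ≤ p (x + a)) (h : ∫⁻ x, p x ≠ ∞) : ∀ᵐ x, p x = 0 := by
  filter_upwards [ae_tsum_ne_top (abs_pos.2 ha) hp h] with x hx
  have hm : Monotone fun k : ℤ => p (x + a * k) := by
    refine monotone_int_of_le_succ fun k => (hmono _).trans_eq ?_
    push_cast
    congr 1
    ring
  have hs : ∑' k : ℤ, p (x + a * k) ≠ ∞ := by
    rcases abs_choice a with h1 | h1
    · rwa [h1] at hx
    · rw [← (Equiv.neg ℤ).tsum_eq]
      convert! hx using 5 with k
      rw [h1]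
      simp
  simpa using eq_zero_of_monotone_of_tsum_ne_top hm hs 0

theorem ae_forall_add_lattice {P : ℝ → Prop} (h : ∀ᵐ x, P x) (a b : ℝ) :
    ∀ᵐ x, ∀ k l : ℤ, P (x + a * k + b * l) := by
  refine ae_all_iff.2 fun k => ae_all_iff.2 fun l => ?_
  have := (measurePreserving_add_right volume (a * k + b * l)).quasiMeasurePreserving.ae h
  simpa only [add_assoc] using this

/-- A system of equations with `b`-periodic coefficients expressing each of finitely many
square-integrable functions through translates of them, all by positive multiples of `a`, has
only the trivial solution. -/
theorem ae_eq_zero_of_periodic_recurrence {ι S : Type*} [Fintype ι] [Fintype S] {a b : ℝ}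
    (ha : a ≠ 0) (hb : 0 < b) (g : ι → ℝ → ℂ) (hg : ∀ i, Measurable (g i))
    (hg2 : ∀ i, ∫⁻ x, ‖g i x‖ₑ ^ 2 ≠ ∞) (r : ι → S → ι) (m : ι → S → ℤ) (hm : ∀ i s, 0 < m i s)
    (τ : ι → S → ℝ → ℂ) (hτ : ∀ i s, Function.Periodic (τ i s) b)
    (h : ∀ i, ∀ᵐ x, g i x = ∑ s, τ i s x * g (r i s) (x + a * m i s)) (i : ι) :
    ∀ᵐ x, g i x = 0 := by
  have hsq (i) : Measurable fun x => ‖g i x‖ₑ ^ 2 := (hg i).enorm.pow_const 2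
  let Φ (i : ι) (x : ℝ) : ℝ≥0∞ := ∑' l : ℤ, ‖g i (x + b * l)‖ₑ ^ 2
  let p (x : ℝ) : ℝ≥0∞ := ⨆ i, ⨆ k : ℕ, ‖g i (x - a * k)‖ₑ ^ 2 / Φ i (x - a * k)
  have hΦ (i) : Measurable (Φ i) :=
    Measurable.tsum fun l => (hsq i).comp (measurable_id.add_const _)
  have hp : Measurable p := Measurable.iSup fun i => Measurable.iSup fun k =>
    ((hsq i).div (hΦ i)).comp (measurable_id.sub_const _)
  have hmono (x) : p x ≤ p (x + a) := by
    refine iSup_le fun i => iSup_le fun k => le_iSup_of_le i (le_iSup_of_le (k + 1) (le_of_eq ?_))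
    have : x + a - a * ((k + 1 : ℕ) : ℝ) = x - a * k := by
      push_cast
      ring
    rw [this]
  have hfin : ∀ᵐ x, ∀ i, Φ i x ≠ ∞ :=
    ae_all_iff.2 fun i => ae_tsum_ne_top hb (hsq i) (hg2 i)
  obtain ⟨M, hM⟩ : ∃ M : ℕ, ∀ i s, m i s ≤ M := by
    refine ⟨∑ i, ∑ s, (m i s).toNat, fun i s => ?_⟩
    have h1 := Finset.single_le_sum (f := fun s => (m i s).toNat) (fun _ _ => Nat.zero_le _)
      (Finset.mem_univ s)
    have h2 := Finset.single_le_sum (f := fun i => ∑ s, (m i s).toNat) (fun _ _ => Nat.zero_le _)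
      (Finset.mem_univ i)
    omega
  have hbound : ∀ᵐ x, ∑' l : ℤ, p (x + b * l) ≤ Fintype.card (ι × Fin M) := by
    filter_upwards [ae_forall_add_lattice hfin a b,
      ae_forall_add_lattice (ae_all_iff.2 h) a b] with x hx1 hx2
    have hx1' (i : ι) (k : ℤ) : Φ i (x + a * k) ≠ ∞ := by simpa using hx1 k 0 i
    let v (i : ι) (k : ℤ) : lp (fun _ : ℤ => ℂ) 2 :=
      ⟨fun l => g i (x + a * k + b * l), memℓp_two_of_tsum_enorm_sq_ne_top (hx1' i k)⟩
    have hv (i k) : ‖v i k‖ₑ ^ 2 = Φ i (x + a * k) := (lp_tsum_enorm_sq (v i k)).symm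
    obtain ⟨W, hW, hcard, hvW⟩ := exists_finrank_le_of_recurrence M r m hm hM v
      (fun i s k => τ i s (x + a * k)) fun i k => by
        ext l
        rw [lp.coeFn_sum, Finset.sum_apply]
        simp only [lp.coeFn_smul, Pi.smul_apply, smul_eq_mul]
        change g i (x + a * k + b * l) =
          ∑ s, τ i s (x + a * k) * g (r i s) (x + a * (k + m i s : ℤ) + b * l)
        rw [hx2 k l i]
        refine Finset.sum_congr rfl fun s _ => ?_
        have h1 : τ i s (x + a * k + b * l) = τ i s (x + a * k) := by
          rw [mul_comm b]
          exact (hτ i s).int_mul l _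
        rw [h1]
        congr 2
        push_cast
        ring
    obtain ⟨D, hD, hDW⟩ := exists_diagonal_bound W
    calc ∑' l : ℤ, p (x + b * l) ≤ ∑' l, D l := by
          refine ENNReal.tsum_le_tsum fun l => iSup_le fun i => iSup_le fun k => ?_
          refine ENNReal.div_le_of_le_mul ?_
          have h1 := hDW _ (hvW i (-k) (by omega)) l
          rw [hv] at h1
          have h2 : x + b * l - a * k = x + a * (-k : ℤ) + b * l := by
            push_cast
            ring
          have h3 : Φ i (x + b * l - a * k) = Φ i (x + a * (-k : ℤ)) := by
            simp only [Φ, h2]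
            rw [← (Equiv.addLeft l).tsum_eq
              (fun j : ℤ => ‖g i (x + a * (-k : ℤ) + b * j)‖ₑ ^ 2)]
            refine tsum_congr fun j => ?_
            congr 3
            rw [Equiv.coe_addLeft]
            push_cast
            ring
          rw [h3, h2]
          exact h1
      _ = Module.finrank ℂ W := hD
      _ ≤ _ := by exact_mod_cast hcard
  have hint : ∫⁻ x, p x ≠ ∞ := by
    rw [lintegral_eq_lintegral_Ioc_tsum hb 0 hp]
    refine ne_top_of_le_ne_top ?_ (lintegral_mono_ae (ae_restrict_of_ae hbound))
    rw [setLIntegral_const]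
    exact ENNReal.mul_ne_top (ENNReal.natCast_ne_top _) (by simp)
  filter_upwards [ae_eq_zero_of_le_add ha hp hmono hint, hfin] with x hx1 hx2
  have h1 : ‖g i x‖ₑ ^ 2 / Φ i x = 0 := by
    have := ENNReal.iSup_eq_zero.1 (ENNReal.iSup_eq_zero.1 hx1 i) 0
    simpa using this
  simpa [ENNReal.div_eq_zero_iff, hx2 i] using h1

theorem lintegral_enorm_sq_ne_top (f : L2R) : ∫⁻ x, ‖f x‖ₑ ^ 2 ≠ ∞ := by
  have := (lintegral_rpow_enorm_lt_top_of_eLpNorm_lt_top (by norm_num) (by norm_num)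
    (Lp.eLpNorm_lt_top f)).ne
  simpa using this

/-- A system of equations of translates in `L²(ℝ)` with `b`-periodic coefficients, in which the
translation on the left lies strictly to one side of all those on the right, has only the trivial
solution. -/
theorem eq_zero_of_translation_system {ι S : Type*} [Fintype ι] [Fintype S] {a b : ℝ}
    (ha : a ≠ 0) (hb : 0 < b) (g : ι → L2R) (r : ι → S → ι) (n₀ : ℤ) (n : ι → S → ℤ)
    (hn : (∀ i s, n i s < n₀) ∨ ∀ i s, n₀ < n i s)
    (τ : ι → S → ℝ → ℂ) (hτ : ∀ i s, Function.Periodic (τ i s) b)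
    (h : ∀ i, ∀ᵐ x, translationOp (a * n₀) (g i) x =
      ∑ s, τ i s x * translationOp (a * n i s) (g (r i s)) x) (i : ι) : g i = 0 := by
  have h' (i) : ∀ᵐ x, g i x =
      ∑ s, τ i s (x + a * n₀) * g (r i s) (x + a * (n₀ - n i s : ℤ)) := by
    have h1 : ∀ᵐ x, g i (x - a * n₀) = ∑ s, τ i s x * g (r i s) (x - a * n i s) := by
      filter_upwards [h i, translationOp_ae (a * n₀) (g i), ae_all_iff.2 fun s =>
        translationOp_ae (a * n i s) (g (r i s))] with x h1 h2 h3
      rw [← h2, h1]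
      exact Finset.sum_congr rfl fun s _ => by rw [h3]
    filter_upwards [(measurePreserving_add_right volume (a * n₀)).quasiMeasurePreserving.ae h1]
      with x hx
    rw [add_sub_cancel_right] at hx
    rw [hx]
    refine Finset.sum_congr rfl fun s _ => ?_
    congr 2
    push_cast
    ring
  have hτ' (i s) : Function.Periodic (fun x => τ i s (x + a * n₀)) b := fun x => by
    simpa only [add_right_comm] using hτ i s (x + a * n₀)
  have hg (i) : Measurable (g i) := (Lp.stronglyMeasurable (g i)).measurable
  rw [Lp.eq_zero_iff_ae_eq_zero]
  rcases hn with hn | hn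
  · exact ae_eq_zero_of_periodic_recurrence ha hb (fun i => g i) hg
      (fun i => lintegral_enorm_sq_ne_top (g i)) r (fun i s => n₀ - n i s)
      (fun i s => sub_pos.2 (hn i s)) _ hτ' h' i
  · refine ae_eq_zero_of_periodic_recurrence (neg_ne_zero.2 ha) hb (fun i => g i) hg
      (fun i => lintegral_enorm_sq_ne_top (g i)) r (fun i s => n i s - n₀)
      (fun i s => sub_pos.2 (hn i s)) _ hτ' (fun i => ?_) i
    filter_upwards [h' i] with x hx
    rw [hx]
    refine Finset.sum_congr rfl fun s _ => ?_
    congr 2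
    push_cast
    ring

theorem mainTheorem3 (a b : ℝ) (ha : 0 < a) (hb : 0 < b) (N : ℕ) (hN : 1 ≤ N)
    (σ : Fin N → Fin N → ℝ → OnePoint ℂ) (hσ : ∀ i j, IsPeriodicAEFinite b (σ i j))
    (n₀ : ℤ) (n : Fin N → Fin N → ℤ)
    (hn : n₀ ∉ Set.Icc (⨅ p : Fin N × Fin N, n p.1 p.2) (⨆ p : Fin N × Fin N, n p.1 p.2)) :
    ¬ SolvableOn b (fun _ _ => ((1 : ℂ) : OnePoint ℂ)) σ
        (fun _ => a * n₀) (fun i j => a * n i j) Set.univ ∧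
    ∀ g : Fin N → L2R, (∃ i, g i ≠ 0) →
      ∃ i, 0 < volume {x : ℝ | translationOp (a * n₀) (g i) x
        ≠ ∑ j, finiteValue (σ i j x) * translationOp (a * n i j) (g i) x} := by
  have hn' : (∀ i j, n i j < n₀) ∨ ∀ i j, n₀ < n i j := by
    rw [Set.mem_Icc, not_and_or, not_le, not_le] at hn
    rcases hn with hn | hn
    · exact Or.inr fun i j => hn.trans_le (ciInf_le (Set.finite_range _).bddBelow (i, j))
    · exact Or.inl fun i j => (le_ciSup (Set.finite_range fun p : Fin N × Fin N => n p.1 p.2).bddAbove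
        (i, j)).trans_lt hn
  have hτ (i j) : Function.Periodic (fun x => finiteValue (σ i j x)) b :=
    fun x => congrArg finiteValue ((hσ i j).1 x)
  refine ⟨?_, fun g ⟨i₀, hi₀⟩ => ?_⟩
  · rintro ⟨g, ⟨i₀, hi₀⟩, hg⟩
    refine hi₀ (eq_zero_of_translation_system ha.ne' hb g (fun _ j => j) n₀ n hn' _ hτ
      (fun i => ?_) i₀)
    filter_upwards [hg i] with x hx
    have hx' := hx ⟨x, Set.mem_univ x, 0, by simp⟩
    rwa [show finiteValue ((1 : ℂ) : OnePoint ℂ) = 1 from rfl, one_mul] at hx'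
  · by_contra! hcon
    exact hi₀ (eq_zero_of_translation_system ha.ne' hb g (fun i _ => i) n₀ n hn' _ hτ
      (fun i => ae_iff.2 (nonpos_iff_eq_zero.1 (hcon i))) i₀)
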